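/- Let $\mathcal A$ be a unital $C^*$-algebra, let $\mathcal B$ be a von Neumann algebra, and let $\phi,\psi:\mathcal A\to\mathcal B$ be unital completely positive maps. A joint representation tuple of $(\phi,\psi)$ is a tuple $(\mathcal E,\sigma_1,\sigma_2,x)$ consisting of a (right) Hilbert $\mathcal B$-module $\mathcal E$, two unital $*$-homomorphisms $\sigma_1,\sigma_2:\mathcal A\to\mathcal B^a(\mathcal E)$ into the $C^*$-algebra of bounded adjointable operators on $\mathcal E$, and a vector $x\in\mathcal E$ with $\langle x,x\rangle=1$, such that $$\phi(a)=\langle x,\sigma_1(a)x\rangle,\qquad \psi(a)=\langle x,\sigma_2(a)x\rangle\qquad(a\in\mathcal A).$$ For unital $C^*$-algebras $\mathcal A,\mathcal B$ in general, the representation distance of two unital completely positive maps is $$\gamma(\phi,\psi)=\inf_{(\mathcal E,\sigma_1,\sigma_2,x)}\|\sigma_1-\sigma_2\|_{cb},$$ the infimum being taken over all joint representation tuples of $(\phi,\psi)$, where $\|\cdot\|_{cb}$ is the completely bounded norm. For $n\ge1$ let $\phi^{(n)},\psi^{(n)}:M_n(\mathcal A)\to M_n(\mathcal B)$ be the ampliations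 $[a_{ij}]\mapsto[\phi(a_{ij})]$ and $[a_{ij}]\mapsto[\psi(a_{ij})]$, which are again unital completely positive. Then for every $n\ge1$ $$\gamma(\phi,\psi)=\gamma(\phi^{(n)},\psi^{(n)}).$$ -/

import Mathlib

open scoped CStarAlgebra

universe u v

noncomputable section

/-! ### Hilbert modules and adjointable operators

Mathlib's `CStarModule C E` is a left `C`-module whose inner product satisfies
`⟪x, c • y⟫ = c * ⟪x, y⟫`.  A (right) Hilbert `B`-module is therefore a complete
`CStarModule Bᵐᵒᵖ E`: writing `y b = op b • y`, one has `⟪x, y b⟫ = ⟪x, y⟫ b` for the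
`B`-valued inner product `rightInner`. -/

/-- The `B`-valued inner product of a right Hilbert `B`-module; it is conjugate linear in the
first variable, linear in the second one, and `⟨x, y b⟩ = ⟨x, y⟩ b`. -/
def rightInner (B : Type*) [CStarAlgebra B] [PartialOrder B] {E : Type*}
    [NormedAddCommGroup E] [NormedSpace ℂ E] [Module Bᵐᵒᵖ E] [CStarModule Bᵐᵒᵖ E]
    (x y : E) : B :=
  MulOpposite.unop (inner Bᵐᵒᵖ x y)

section Inner

variable {B : Type*} [CStarAlgebra B] [PartialOrder B] {E : Type*}
  [NormedAddCommGroup E] [NormedSpace ℂ E] [Module Bᵐᵒᵖ E] [CStarModule Bᵐᵒᵖ E]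

theorem rightInner_op_smul (x y : E) (b : B) :
    rightInner B x (MulOpposite.op b • y) = rightInner B x y * b := by
  simp [rightInner]

theorem rightInner_self_nonneg (x : E) : 0 ≤ rightInner B x x :=
  CStarModule.inner_self_nonneg (A := Bᵐᵒᵖ) (x := x)

theorem rightInner_star (x y : E) : star (rightInner B x y) = rightInner B y x := by
  rw [rightInner, ← MulOpposite.unop_star, CStarModule.star_inner, rightInner]

theorem rightInner_add_right (x y z : E) :
    rightInner B x (y + z) = rightInner B x y + rightInner B x z := by
  simp [rightInner]

theorem rightInner_smul_right (x y : E) (c : ℂ) :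
    rightInner B x (c • y) = c • rightInner B x y := by
  simp [rightInner]

theorem rightInner_sub_right (x y z : E) :
    rightInner B x (y - z) = rightInner B x y - rightInner B x z := by
  simp [rightInner]

theorem rightInner_zero_right (x : E) : rightInner B x 0 = 0 := by
  simp [rightInner]

theorem rightInner_add_left (x y z : E) :
    rightInner B (x + y) z = rightInner B x z + rightInner B y z := by
  simp [rightInner]

theorem rightInner_smul_left (x y : E) (c : ℂ) :
    rightInner B (c • x) y = star c • rightInner B x y := by
  simp [rightInner]

theorem rightInner_sub_left (x y z : E) :
    rightInner B (x - y) z = rightInner B x z - rightInner B y z := by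
  simp [rightInner]

theorem rightInner_zero_left (x : E) : rightInner B 0 x = 0 := by
  simp [rightInner]

theorem norm_sq_eq_norm_rightInner (x : E) : ‖x‖ ^ 2 = ‖rightInner B x x‖ :=
  CStarModule.norm_sq_eq (A := Bᵐᵒᵖ)

theorem norm_rightInner_le [StarOrderedRing B] (x y : E) : ‖rightInner B x y‖ ≤ ‖x‖ * ‖y‖ :=
  CStarModule.norm_inner_le (A := Bᵐᵒᵖ) E

theorem ext_rightInner {x y : E} (h : ∀ z : E, rightInner B z x = rightInner B z y) : x = y := by
  rw [← sub_eq_zero, ← CStarModule.inner_self (A := Bᵐᵒᵖ)]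
  apply MulOpposite.unop_injective
  have := h (x - y)
  rw [← sub_eq_zero, ← rightInner_sub_right] at this
  exact this

end Inner

/-- `S` is an adjoint of the bounded operator `T` on the Hilbert `B`-module `E`. -/
def IsModuleAdjoint (B : Type*) [CStarAlgebra B] [PartialOrder B] {E : Type*}
    [NormedAddCommGroup E] [NormedSpace ℂ E] [Module Bᵐᵒᵖ E] [CStarModule Bᵐᵒᵖ E]
    (T S : E →L[ℂ] E) : Prop :=
  ∀ x y : E, rightInner B (T x) y = rightInner B x (S y)

/-- The algebra of bounded adjointable operators inside the bounded operators on `E`. -/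
def adjointableSubalgebra (B : Type*) [CStarAlgebra B] [PartialOrder B] (E : Type*)
    [NormedAddCommGroup E] [NormedSpace ℂ E] [Module Bᵐᵒᵖ E] [CStarModule Bᵐᵒᵖ E] :
    Subalgebra ℂ (E →L[ℂ] E) where
  carrier := {T | ∃ S, IsModuleAdjoint B T S}
  mul_mem' := by
    rintro T T' ⟨S, hS⟩ ⟨S', hS'⟩
    exact ⟨S' * S, fun x y => by
      rw [mul_apply_eq_comp, hS, hS', mul_apply_eq_comp]⟩
  add_mem' := by
    rintro T T' ⟨S, hS⟩ ⟨S', hS'⟩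
    exact ⟨S + S', fun x y => by
      rw [_root_.add_apply, rightInner_add_left, hS, hS',
        _root_.add_apply, rightInner_add_right]⟩
  algebraMap_mem' c := ⟨star c • 1, fun x y => by
    rw [Algebra.algebraMap_eq_smul_one, _root_.smul_apply,
      _root_.smul_apply, one_apply_eq_self,
      one_apply_eq_self, rightInner_smul_left, rightInner_smul_right]⟩

/-- The C⋆-algebra `𝓑ᵃ(E)` of bounded adjointable operators on the Hilbert `B`-module `E`, with the
composition as product, the adjoint as involution and the operator norm. -/
def AdjointableOp (B : Type*) [CStarAlgebra B] [PartialOrder B] (E : Type*)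
    [NormedAddCommGroup E] [NormedSpace ℂ E] [Module Bᵐᵒᵖ E] [CStarModule Bᵐᵒᵖ E] : Type _ :=
  ↥(adjointableSubalgebra B E)

namespace AdjointableOp

variable {B : Type*} [CStarAlgebra B] [PartialOrder B] {E : Type*}
  [NormedAddCommGroup E] [NormedSpace ℂ E] [Module Bᵐᵒᵖ E] [CStarModule Bᵐᵒᵖ E]

instance : NormedRing (AdjointableOp B E) :=
  inferInstanceAs (NormedRing ↥(adjointableSubalgebra B E))

instance : NormedAlgebra ℂ (AdjointableOp B E) :=
  inferInstanceAs (NormedAlgebra ℂ ↥(adjointableSubalgebra B E))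

/-- The underlying bounded operator. -/
def toCLM (T : AdjointableOp B E) : E →L[ℂ] E := T.1

instance : CoeFun (AdjointableOp B E) (fun _ => E → E) where
  coe T := T.toCLM

theorem toCLM_injective : Function.Injective (toCLM : AdjointableOp B E → (E →L[ℂ] E)) :=
  Subtype.val_injective

theorem toCLM_add (S T : AdjointableOp B E) : (S + T).toCLM = S.toCLM + T.toCLM := rfl

theorem toCLM_mul (S T : AdjointableOp B E) : (S * T).toCLM = S.toCLM * T.toCLM := rfl

theorem toCLM_smul (c : ℂ) (T : AdjointableOp B E) : (c • T).toCLM = c • T.toCLM := rfl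

theorem norm_def (T : AdjointableOp B E) : ‖T‖ = ‖T.toCLM‖ := rfl

theorem IsModuleAdjoint.symm {T S : E →L[ℂ] E} (h : IsModuleAdjoint B T S) :
    IsModuleAdjoint B S T := fun x y => by
  rw [← rightInner_star, ← h, rightInner_star]

instance : Star (AdjointableOp B E) where
  star T := ⟨T.2.choose, T.1, IsModuleAdjoint.symm T.2.choose_spec⟩

/-- The involution is the adjoint. -/
theorem rightInner_left (T : AdjointableOp B E) (x y : E) :
    rightInner B (T x) y = rightInner B x (star T y) :=
  T.2.choose_spec x y

theorem ext_of_rightInner {S T : AdjointableOp B E}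
    (h : ∀ x y : E, rightInner B x (S y) = rightInner B x (T y)) : S = T :=
  toCLM_injective (ContinuousLinearMap.ext fun y => ext_rightInner fun x => h x y)

theorem rightInner_right (T : AdjointableOp B E) (x y : E) :
    rightInner B x (T y) = rightInner B (star T x) y := by
  rw [← rightInner_star, rightInner_left, rightInner_star]

instance : StarRing (AdjointableOp B E) where
  star_involutive T := ext_of_rightInner fun x y => by
    rw [← rightInner_left, ← rightInner_right]
  star_mul S T := ext_of_rightInner fun x y => by
    rw [← rightInner_left, toCLM_mul, toCLM_mul, mul_apply_eq_comp,
      mul_apply_eq_comp, rightInner_left, rightInner_left]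
  star_add S T := ext_of_rightInner fun x y => by
    rw [← rightInner_left, toCLM_add, toCLM_add, _root_.add_apply,
      _root_.add_apply, rightInner_add_left, rightInner_add_right,
      rightInner_left, rightInner_left]

instance : StarModule ℂ (AdjointableOp B E) where
  star_smul c T := ext_of_rightInner fun x y => by
    rw [← rightInner_left, toCLM_smul, toCLM_smul, _root_.smul_apply,
      _root_.smul_apply, rightInner_smul_left, rightInner_smul_right,
      rightInner_left]

variable [StarOrderedRing B]

instance : CStarRing (AdjointableOp B E) where
  norm_mul_self_le T := by
    have h : ‖T‖ ≤ √‖star T * T‖ := by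
      refine ContinuousLinearMap.opNorm_le_bound _ (Real.sqrt_nonneg _) fun x => ?_
      refine le_of_sq_le_sq ?_ (by positivity)
      calc ‖T x‖ ^ 2 = ‖rightInner B x ((star T * T).toCLM x)‖ := by
            rw [norm_sq_eq_norm_rightInner (B := B), rightInner_left]
            rfl
        _ ≤ ‖x‖ * ‖(star T * T).toCLM x‖ := norm_rightInner_le _ _
        _ ≤ ‖x‖ * (‖star T * T‖ * ‖x‖) := by
            gcongr
            exact (star T * T).toCLM.le_opNorm x
        _ = (√‖star T * T‖ * ‖x‖) ^ 2 := by
            rw [mul_pow, Real.sq_sqrt (norm_nonneg _)]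
            ring
    calc ‖T‖ * ‖T‖ ≤ √‖star T * T‖ * √‖star T * T‖ := by gcongr
      _ = ‖star T * T‖ := Real.mul_self_sqrt (norm_nonneg _)

instance [CompleteSpace E] : CompleteSpace (AdjointableOp B E) := by
  refine Metric.complete_of_cauchySeq_tendsto fun u hu => ?_
  have hiso : Isometry (toCLM : AdjointableOp B E → (E →L[ℂ] E)) := isometry_subtype_coe
  have hstar : Isometry (star : AdjointableOp B E → AdjointableOp B E) :=
    AddMonoidHomClass.isometry_of_norm (starAddEquiv (R := AdjointableOp B E))
      fun T => norm_star T
  obtain ⟨T, hT⟩ := cauchySeq_tendsto_of_complete (hiso.uniformContinuous.comp_cauchySeq hu)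
  obtain ⟨S, hS⟩ := cauchySeq_tendsto_of_complete
    (hiso.uniformContinuous.comp_cauchySeq (hstar.uniformContinuous.comp_cauchySeq hu))
  have hev : ∀ {F : ℕ → (E →L[ℂ] E)} {L : E →L[ℂ] E},
      Filter.Tendsto F Filter.atTop (nhds L) → ∀ x,
      Filter.Tendsto (fun n => F n x) Filter.atTop (nhds (L x)) := fun h x =>
    ((ContinuousLinearMap.apply ℂ E x).continuous.tendsto _).comp h
  have hcont : Continuous fun p : E × E => rightInner B p.1 p.2 :=
    MulOpposite.continuous_unop.comp (CStarModule.continuous_inner (A := Bᵐᵒᵖ))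
  have hTS : IsModuleAdjoint B T S := fun x y => by
    have h1 := (hcont.tendsto (T x, y)).comp ((hev hT x).prodMk_nhds tendsto_const_nhds)
    have h2 := (hcont.tendsto (x, S y)).comp
      ((tendsto_const_nhds (x := x)).prodMk_nhds (hev hS y))
    refine tendsto_nhds_unique h1 (h2.congr fun n => ?_)
    exact (rightInner_left (u n) x y).symm
  refine ⟨⟨T, S, hTS⟩, ?_⟩
  exact hiso.isEmbedding.tendsto_nhds_iff.2 hT

instance [CompleteSpace E] : CStarAlgebra (AdjointableOp B E) where

instance [CompleteSpace E] : PartialOrder (AdjointableOp B E) := CStarAlgebra.spectralOrder _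

instance [CompleteSpace E] : StarOrderedRing (AdjointableOp B E) :=
  CStarAlgebra.spectralOrderedRing _

end AdjointableOp

/-! ### Completely bounded norm, unital completely positive maps, ampliations -/

/-- The completely bounded norm `sup_k ‖θ_k‖` of a linear map `θ` between C⋆-algebras, where
`θ_k : M_k(A) → M_k(C)` applies `θ` to the entries. Its value is `∞` if `θ` is not completely
bounded. -/
def cbNorm {A C : Type*} [CStarAlgebra A] [PartialOrder A] [StarOrderedRing A]
    [CStarAlgebra C] [PartialOrder C] [StarOrderedRing C] (θ : A →ₗ[ℂ] C) : ENNReal :=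
  ⨆ (k : ℕ) (M : CStarMatrix (Fin k) (Fin k) A) (_ : ‖M‖ ≤ 1), ‖M.map θ‖ₑ

/-- Unital completely positive maps. -/
structure UCP (A B : Type*) [CStarAlgebra A] [PartialOrder A] [StarOrderedRing A]
    [CStarAlgebra B] [PartialOrder B] [StarOrderedRing B] extends A →CP B where
  map_one' : toFun 1 = 1

instance {A B : Type*} [CStarAlgebra A] [PartialOrder A] [StarOrderedRing A]
    [CStarAlgebra B] [PartialOrder B] [StarOrderedRing B] : CoeFun (UCP A B) (fun _ => A → B) where
  coe φ := φ.toCompletelyPositiveMap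

/-- The identification of `M_k(M_n(A))` with the matrices over `A` indexed by pairs, as an
isomorphism of star-algebras. -/
def CStarMatrix.flatten (k n : ℕ) (A : Type*) [CStarAlgebra A] [PartialOrder A]
    [StarOrderedRing A] :
    CStarMatrix (Fin k) (Fin k) (CStarMatrix (Fin n) (Fin n) A) ≃⋆ₐ[ℂ]
      CStarMatrix (Fin k × Fin n) (Fin k × Fin n) A where
  toFun M := CStarMatrix.ofMatrix fun p q => M p.1 q.1 p.2 q.2
  invFun M := CStarMatrix.ofMatrix fun i j => CStarMatrix.ofMatrix fun s t => M (i, s) (j, t)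
  left_inv _ := rfl
  right_inv _ := rfl
  map_smul' _ _ := rfl
  map_add' _ _ := rfl
  map_mul' M N := by
    ext p q
    have h : ∀ (s : Finset (Fin k)) (f : Fin k → CStarMatrix (Fin n) (Fin n) A) (i j : Fin n),
        (∑ l ∈ s, f l) i j = ∑ l ∈ s, f l i j := fun s f i j =>
      Matrix.sum_apply (α := A) i j s f
    rw [CStarMatrix.mul_apply, Fintype.sum_prod_type]
    change (M * N) p.1 q.1 p.2 q.2 = _
    rw [CStarMatrix.mul_apply, h]
    rfl
  map_star' _ := rfl

theorem starAlgEquiv_nonneg {A B : Type*} [CStarAlgebra A] [PartialOrder A] [StarOrderedRing A]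
    [CStarAlgebra B] [PartialOrder B] [StarOrderedRing B] (e : A ≃⋆ₐ[ℂ] B) {a : A} (ha : 0 ≤ a) :
    0 ≤ e a := map_nonneg e ha

theorem UCP.map_mapₗ_nonneg {A B : Type*} [CStarAlgebra A] [PartialOrder A] [StarOrderedRing A]
    [CStarAlgebra B] [PartialOrder B] [StarOrderedRing B] (n k : ℕ) (φ : UCP A B)
    (M : CStarMatrix (Fin k) (Fin k) (CStarMatrix (Fin n) (Fin n) A)) (hM : 0 ≤ M) :
    0 ≤ M.map (CStarMatrix.mapₗ φ.toLinearMap :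
      CStarMatrix (Fin n) (Fin n) A →ₗ[ℂ] CStarMatrix (Fin n) (Fin n) B) := by
  have h1 : 0 ≤ CStarMatrix.flatten k n A M := starAlgEquiv_nonneg (CStarMatrix.flatten k n A) hM
  have h2 : 0 ≤ (CStarMatrix.flatten k n A M).map φ :=
    CompletelyPositiveMap.map_cstarMatrix_nonneg φ.toCompletelyPositiveMap _ h1
  have h3 : 0 ≤ (CStarMatrix.flatten k n B).symm ((CStarMatrix.flatten k n A M).map φ) :=
    starAlgEquiv_nonneg (CStarMatrix.flatten k n B).symm h2
  exact h3

/-- The ampliation `φ⁽ⁿ⁾ : M_n(A) → M_n(B)`, which applies `φ` to the entries of a matrix. -/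
def UCP.ampliation {A B : Type*} [CStarAlgebra A] [PartialOrder A] [StarOrderedRing A]
    [CStarAlgebra B] [PartialOrder B] [StarOrderedRing B] (n : ℕ) (φ : UCP A B) :
    UCP (CStarMatrix (Fin n) (Fin n) A) (CStarMatrix (Fin n) (Fin n) B) where
  toLinearMap := CStarMatrix.mapₗ φ.toLinearMap
  map_cstarMatrix_nonneg' k M hM := φ.map_mapₗ_nonneg n k M hM
  map_one' := by
    ext i j
    change φ.toLinearMap ((1 : CStarMatrix (Fin n) (Fin n) A) i j) = _
    rw [CStarMatrix.one_apply, CStarMatrix.one_apply]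
    split_ifs
    · exact φ.map_one'
    · exact map_zero _

theorem UCP.ampliation_apply {A B : Type*} [CStarAlgebra A] [PartialOrder A] [StarOrderedRing A]
    [CStarAlgebra B] [PartialOrder B] [StarOrderedRing B] (n : ℕ) (φ : UCP A B)
    (M : CStarMatrix (Fin n) (Fin n) A) (i j : Fin n) : φ.ampliation n M i j = φ (M i j) :=
  rfl

/-! ### The representation distance -/

/-- A joint representation tuple `(E, σ₁, σ₂, x)` of unital completely positive maps
`φ₁, φ₂ : A → B`: a Hilbert `B`-module `E` with two unital left actions `σ₁, σ₂` of `A` by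
adjointable operators and a unit vector `x` such that `φᵢ(a) = ⟨x, σᵢ(a) x⟩`. The universe of `E` is
the one that contains the closed submodule generated by `x` under both actions and `B`. -/
structure JointRepresentation {A : Type u} {B : Type v}
    [CStarAlgebra A] [PartialOrder A] [StarOrderedRing A]
    [CStarAlgebra B] [PartialOrder B] [StarOrderedRing B] (φ₁ φ₂ : UCP A B) where
  E : Type (max u v)
  [normedAddCommGroup : NormedAddCommGroup E]
  [normedSpace : NormedSpace ℂ E]
  [rightModule : Module Bᵐᵒᵖ E]
  [hilbertModule : CStarModule Bᵐᵒᵖ E]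
  [complete : CompleteSpace E]
  σ₁ : A →⋆ₐ[ℂ] AdjointableOp B E
  σ₂ : A →⋆ₐ[ℂ] AdjointableOp B E
  x : E
  unit_vector : rightInner B x x = 1
  repr₁ : ∀ a : A, φ₁ a = rightInner B x (σ₁ a x)
  repr₂ : ∀ a : A, φ₂ a = rightInner B x (σ₂ a x)

attribute [instance] JointRepresentation.normedAddCommGroup JointRepresentation.normedSpace
  JointRepresentation.rightModule JointRepresentation.hilbertModule JointRepresentation.complete

/-- The representation distance `γ(φ₁, φ₂)`: the infimum of `‖σ₁ - σ₂‖_cb` over all joint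
representation tuples. -/
def reprDist {A : Type u} {B : Type v}
    [CStarAlgebra A] [PartialOrder A] [StarOrderedRing A]
    [CStarAlgebra B] [PartialOrder B] [StarOrderedRing B] (φ₁ φ₂ : UCP A B) : ENNReal :=
  ⨅ R : JointRepresentation φ₁ φ₂,
    cbNorm (R.σ₁.toAlgHom.toLinearMap - R.σ₂.toAlgHom.toLinearMap)

end

set_option linter.unusedSectionVars false

noncomputable section

open MulOpposite (op unop)

/-! ### Positive elements of a C⋆-algebra. -/

namespace CStarAlgebra

variable {D : Type*} [CStarAlgebra D] [PartialOrder D] [StarOrderedRing D]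

/-! Joint representation tuples are carried back and forth between `(φ, ψ)` and their ampliations
without increasing the cb-norm of the difference.

From the ampliations down: given `(F, Σ₁, Σ₂, ξ)` over `M_n(B)`, the corner `F eᵢᵢ` is a Hilbert
`B`-module under the `(i, i)` entry of the inner product. Adjointable operators preserve it, so `a ↦
Σⱼ(a ⊗ 1)` restricted to it, with the vector `ξ eᵢᵢ`, represents `(φ, ψ)`
(`JointRepresentation.corner`). Composing with star homomorphisms on either side cannot increase the
cb-norm (`cbNorm_sub_comp_left_le`, `cbNorm_sub_comp_right_le`).

From the maps up: given `(E, σ₁, σ₂, x)`, the matrices `M_n(E)` form a Hilbert `M_n(B)`-module on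
which `M_n(A)` acts through `σⱼ⁽ⁿ⁾` by left multiplication, and the diagonal matrix of `x` is the
vector (`JointRepresentation.ampliation`). Since `M_k(M_n(A)) ≅ M_{kn}(A)`, ampliation does not
increase the cb-norm (`cbNorm_mapₗ_le`).

The delicate point is positivity of the inner product on `M_n(E)`: it is tested on the diagonals of
`N⋆ M N` (`nonneg_of_forall_star_mul_mul_apply_self`). -/

theorem exists_eq_star_mul_self {a : D} (ha : 0 ≤ a) : ∃ c, a = star c * c :=
  CStarAlgebra.nonneg_iff_eq_star_mul_self.1 ha

/-- The negative part `c` of a self-adjoint element `a` satisfies `c a c = -c³`. -/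
theorem exists_star_mul_mul_eq_neg (a : D) (ha : IsSelfAdjoint a) :
    ∃ c : D, 0 ≤ star c * c * c ∧ star c * a * c = -(star c * c * c) ∧
      (star c * c * c = 0 → 0 ≤ a) := by
  have hc0 : 0 ≤ a⁻ := CFC.negPart_nonneg a
  have hcs : star a⁻ = a⁻ := hc0.isSelfAdjoint.star_eq
  refine ⟨a⁻, star_left_conjugate_nonneg hc0 _, ?_, fun hz => ?_⟩
  · have : a * a⁻ = -(a⁻ * a⁻) := by
      nth_rw 1 [← CFC.posPart_sub_negPart a ha]
      rw [sub_mul, CFC.posPart_mul_negPart, zero_sub]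
    rw [mul_assoc, this, mul_neg, mul_assoc]
  · rw [hcs] at hz
    -- With `c = a⁻`, the C⋆-identity is used twice: `c³ = 0` gives `(c²)⋆ c² = 0`, hence `c² = c⋆ c
    -- = 0`, hence `c = 0`.
    have hcc : a⁻ * a⁻ = 0 := by
      rw [← CStarRing.star_mul_self_eq_zero_iff, star_mul, hcs, mul_assoc, ← mul_assoc a⁻ a⁻ a⁻,
        hz, mul_zero]
    rw [← CFC.negPart_eq_zero_iff a ha, ← CStarRing.star_mul_self_eq_zero_iff, hcs, hcc]

end CStarAlgebra

/-! ### Positivity, corners and entrywise homomorphisms for matrix algebras. -/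

namespace CStarMatrix

variable {ι : Type*} [Fintype ι]

theorem star_mul_self_apply_self {B : Type*} [CStarAlgebra B] (C : CStarMatrix ι ι B) (i : ι) :
    (star C * C) i i = ∑ k, star (C k i) * C k i := by
  simp [mul_apply, star_apply]

variable [DecidableEq ι]

section Positivity

variable {B : Type*} [CStarAlgebra B] [PartialOrder B] [StarOrderedRing B]

theorem apply_self_nonneg {M : CStarMatrix ι ι B} (hM : 0 ≤ M) (i : ι) : 0 ≤ M i i := by
  obtain ⟨C, rfl⟩ := CStarAlgebra.exists_eq_star_mul_self hM
  rw [star_mul_self_apply_self]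
  exact Finset.sum_nonneg fun k _ => star_mul_self_nonneg _

/-- If `M = C⋆ C`, each diagonal entry is a sum of the positive elements `C_ki⋆ C_ki`; when the sum
vanishes, so does every `C_ki`. -/
theorem eq_zero_of_nonneg_of_apply_self_nonpos {M : CStarMatrix ι ι B} (hM : 0 ≤ M)
    (h : ∀ i, M i i ≤ 0) : M = 0 := by
  obtain ⟨C, rfl⟩ := CStarAlgebra.exists_eq_star_mul_self hM
  have hC : C = 0 := by
    ext k i
    have h0 : ∑ k, star (C k i) * C k i = 0 := by
      rw [← star_mul_self_apply_self]
      exact le_antisymm (h i) (apply_self_nonneg hM i)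
    have := (Finset.sum_eq_zero_iff_of_nonneg fun k _ => star_mul_self_nonneg (C k i)).1 h0 k
      (Finset.mem_univ k)
    simpa using this
  simp [hC]

/-- A self-adjoint matrix is positive as soon as its quadratic form is. -/
theorem nonneg_of_forall_star_mul_mul_apply_self {M : CStarMatrix ι ι B} (hM : IsSelfAdjoint M)
    (h : ∀ (N : CStarMatrix ι ι B) (i : ι), 0 ≤ (star N * M * N) i i) : 0 ≤ M := by
  -- For `N = M⁻` one has `N⋆ M N = -N³`, so the hypothesis makes the diagonal of the positive
  -- matrix `N³` nonpositive.
  obtain ⟨N, hN, hMN, hM0⟩ := CStarAlgebra.exists_star_mul_mul_eq_neg M hM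
  refine hM0 (eq_zero_of_nonneg_of_apply_self_nonpos hN fun i => ?_)
  have := h N i
  rw [hMN, neg_apply] at this
  exact neg_nonneg.1 this

end Positivity

/-- The embedding `b ↦ b ⊗ eᵢᵢ` of a C⋆-algebra as a corner of its matrix algebra. -/
def cornerHom (B : Type*) [CStarAlgebra B] (i : ι) : B →⋆ₙₐ[ℂ] CStarMatrix ι ι B where
  toFun b := ofMatrix (Matrix.single i i b)
  map_smul' c b := by
    ext k l
    simp [Matrix.single_apply]
  map_zero' := by simp
  map_add' a b := by simp [Matrix.single_add]
  map_mul' a b := (congrArg ofMatrix (Matrix.single_mul_single_same (i := i) (j := i) (k := i) (c := a) (d := b))).symm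
  map_star' b := by
    ext k l
    rw [star_apply]
    simp only [ofMatrix_apply, Matrix.single_apply, and_comm]
    split_ifs <;> simp

section Corner

variable {B : Type*} [CStarAlgebra B] (i : ι)

theorem cornerHom_apply (b : B) (k l : ι) :
    cornerHom B i b k l = if i = k ∧ i = l then b else 0 := Matrix.single_apply ..

theorem cornerHom_apply_self (b : B) : cornerHom B i b i i = b := by simp [cornerHom_apply]

theorem mul_cornerHom_apply_self (M : CStarMatrix ι ι B) (b : B) :
    (M * cornerHom B i b) i i = M i i * b := by
  simp [mul_apply, cornerHom_apply]

theorem cornerHom_mul_mul_cornerHom (M : CStarMatrix ι ι B) (a b : B) :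
    cornerHom B i a * M * cornerHom B i b = cornerHom B i (a * M i i * b) := by
  ext k l
  by_cases hk : i = k <;> by_cases hl : i = l <;> simp [mul_apply, cornerHom_apply, ite_and, hk, hl]

theorem cornerHom_injective : Function.Injective (cornerHom B i) := fun a b h => by
  rw [← cornerHom_apply_self i a, h, cornerHom_apply_self]

theorem norm_cornerHom [PartialOrder B] [StarOrderedRing B] (b : B) : ‖cornerHom B i b‖ = ‖b‖ :=
  NonUnitalStarAlgHom.norm_map (cornerHom B i) (cornerHom_injective i) b

end Corner

/-- The embedding `a ↦ a ⊗ 1` of a C⋆-algebra as scalar matrices. -/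
def scalarHom (ι : Type*) [Fintype ι] [DecidableEq ι] (A : Type*) [CStarAlgebra A] :
    A →⋆ₐ[ℂ] CStarMatrix ι ι A where
  toFun a := ofMatrix (Matrix.diagonal fun _ => a)
  map_one' := Matrix.diagonal_one
  map_zero' := Matrix.diagonal_zero
  map_add' _ _ := (Matrix.diagonal_add _ _).symm
  map_mul' _ _ := (Matrix.diagonal_mul_diagonal _ _).symm
  commutes' _ := rfl
  map_star' _ := (Matrix.diagonal_conjTranspose _).symm

theorem scalarHom_apply_self {A : Type*} [CStarAlgebra A] (a : A) (i : ι) :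
    scalarHom ι A a i i = a := Matrix.diagonal_apply_eq _ _

/-- The application of a unital star homomorphism to the entries of a matrix. -/
def mapHom (ι : Type*) [Fintype ι] [DecidableEq ι] {A C : Type*} [CStarAlgebra A]
    [CStarAlgebra C] (f : A →⋆ₐ[ℂ] C) : CStarMatrix ι ι A →⋆ₐ[ℂ] CStarMatrix ι ι C where
  toFun M := M.map f
  map_one' := by
    ext i j
    simp only [map_apply, one_apply]
    split_ifs <;> simp
  map_zero' := by ext i j; simp
  map_add' M N := by ext i j; simp
  map_mul' M N := by ext i j; simp [mul_apply]
  commutes' c := by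
    ext i j
    simp only [map_apply, Algebra.algebraMap_eq_smul_one, smul_apply, one_apply]
    split_ifs <;> simp
  map_star' M := by
    ext i j
    simp only [map_apply, star_apply]
    exact map_star f _

end CStarMatrix

/-! ### Stability of the completely bounded norm. -/

section cbNorm

variable {A C : Type*} [CStarAlgebra A] [PartialOrder A] [StarOrderedRing A]
  [CStarAlgebra C] [PartialOrder C] [StarOrderedRing C]

theorem enorm_map_le_cbNorm (θ : A →ₗ[ℂ] C) {k : ℕ} {M : CStarMatrix (Fin k) (Fin k) A}
    (hM : ‖M‖ ≤ 1) : ‖M.map θ‖ₑ ≤ cbNorm θ :=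
  le_iSup_of_le k (le_iSup_of_le M (le_iSup_of_le hM le_rfl))

/-- Applied entrywise, `r` is again a star homomorphism between matrix algebras, hence contractive
at every level. -/
theorem cbNorm_sub_comp_left_le {C' : Type*} [CStarAlgebra C'] [PartialOrder C']
    [StarOrderedRing C'] (r : C →⋆ₐ[ℂ] C') (s t : A →⋆ₐ[ℂ] C) :
    cbNorm ((r.comp s).toAlgHom.toLinearMap - (r.comp t).toAlgHom.toLinearMap) ≤
      cbNorm (s.toAlgHom.toLinearMap - t.toAlgHom.toLinearMap) := by
  refine iSup_le fun k => iSup_le fun M => iSup_le fun hM => ?_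
  have h : M.map ((r.comp s).toAlgHom.toLinearMap - (r.comp t).toAlgHom.toLinearMap) =
      CStarMatrix.mapHom (Fin k) r (M.map (s.toAlgHom.toLinearMap - t.toAlgHom.toLinearMap)) :=
    CStarMatrix.ext fun i j => (map_sub r (s (M i j)) (t (M i j))).symm
  rw [h]
  exact (enorm_le_iff_norm_le.2 (NonUnitalStarAlgHom.norm_apply_le _ _)).trans
    (enorm_map_le_cbNorm _ hM)

theorem cbNorm_sub_comp_right_le {A' : Type*} [CStarAlgebra A'] [PartialOrder A']
    [StarOrderedRing A'] (s t : A →⋆ₐ[ℂ] C) (d : A' →⋆ₐ[ℂ] A) :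
    cbNorm ((s.comp d).toAlgHom.toLinearMap - (t.comp d).toAlgHom.toLinearMap) ≤
      cbNorm (s.toAlgHom.toLinearMap - t.toAlgHom.toLinearMap) := by
  refine iSup_le fun k => iSup_le fun M => iSup_le fun hM => ?_
  exact enorm_map_le_cbNorm (s.toAlgHom.toLinearMap - t.toAlgHom.toLinearMap)
    (M := CStarMatrix.mapHom (Fin k) d M)
    ((NonUnitalStarAlgHom.norm_apply_le (CStarMatrix.mapHom (Fin k) d) M).trans hM)

/-- Ampliations do not increase the completely bounded norm. -/
theorem cbNorm_mapₗ_le (n : ℕ) (θ : A →ₗ[ℂ] C) :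
    cbNorm (CStarMatrix.mapₗ θ :
      CStarMatrix (Fin n) (Fin n) A →ₗ[ℂ] CStarMatrix (Fin n) (Fin n) C) ≤ cbNorm θ := by
  refine iSup_le fun k => iSup_le fun M => iSup_le fun hM => ?_
  -- `cbNorm` only sees matrices indexed by some `Fin k`, so pairs are reindexed by `Fin (k * n)`.
  -- Both identifications are star isomorphisms, hence isometric, and commute with entrywise `θ`.
  let eA := (CStarMatrix.flatten k n A).trans (CStarMatrix.reindexₐ ℂ A finProdFinEquiv)
  let eC := (CStarMatrix.flatten k n C).trans (CStarMatrix.reindexₐ ℂ C finProdFinEquiv)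
  have h1 : ‖eA M‖ ≤ 1 := (StarAlgEquiv.norm_map eA M).trans_le hM
  have h2 : (eA M).map θ = eC (M.map (CStarMatrix.mapₗ θ)) := rfl
  have h3 := enorm_map_le_cbNorm θ h1
  rw [h2] at h3
  refine le_trans (enorm_le_iff_norm_le.2 ?_) h3
  exact (StarAlgEquiv.norm_map eC _).ge

end cbNorm

/-! ### Inner product calculus for Hilbert modules. -/

section HilbertModule

variable {B : Type*} [CStarAlgebra B] [PartialOrder B] {E : Type*}
  [NormedAddCommGroup E] [NormedSpace ℂ E] [Module Bᵐᵒᵖ E] [CStarModule Bᵐᵒᵖ E]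

theorem rightInner_op_smul_left (x y : E) (b : B) :
    rightInner B (op b • x) y = star b * rightInner B x y := by
  rw [← rightInner_star, rightInner_op_smul, star_mul, rightInner_star]

/-- Only `ℂ`-linearity is built into the operators; linearity over `B` is forced by the existence of
an adjoint. -/
theorem AdjointableOp.map_op_smul (T : AdjointableOp B E) (b : B) (x : E) :
    T (op b • x) = op b • T x :=
  ext_rightInner (B := B) fun z => by
    simp only [rightInner_op_smul, AdjointableOp.rightInner_right]

theorem continuous_rightInner_right [StarOrderedRing B] (z : E) : Continuous fun x : E => rightInner B z x :=
  MulOpposite.continuous_unop.comp ((CStarModule.continuous_inner (A := Bᵐᵒᵖ)).comp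
    (Continuous.prodMk_right z))

theorem rightInner_sum_right {κ : Type*} (s : Finset κ) (x : E) (y : κ → E) :
    rightInner B x (∑ k ∈ s, y k) = ∑ k ∈ s, rightInner B x (y k) := by
  simp [rightInner]

theorem rightInner_sum_left {κ : Type*} (s : Finset κ) (x : κ → E) (y : E) :
    rightInner B (∑ k ∈ s, x k) y = ∑ k ∈ s, rightInner B (x k) y := by
  simp [rightInner]

end HilbertModule

/-! ### The corner of a Hilbert module over a matrix algebra -/

section Corner

variable {ι : Type*} [Fintype ι] [DecidableEq ι]
  (B : Type*) [CStarAlgebra B] [PartialOrder B] [StarOrderedRing B]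
  (F : Type*) [NormedAddCommGroup F] [NormedSpace ℂ F] [Module (CStarMatrix ι ι B)ᵐᵒᵖ F]
  [CStarModule (CStarMatrix ι ι B)ᵐᵒᵖ F] (i : ι)

/-- The closed subspace `F · eᵢᵢ` of a Hilbert module `F` over the matrices with entries in `B`. -/
def cornerSubmodule : Submodule ℂ F where
  -- This is `x eᵢᵢ = x` tested against all `z`, a form that makes closedness and invariance under
  -- adjointable operators immediate.
  carrier := {x | ∀ z : F, rightInner (CStarMatrix ι ι B) z x * CStarMatrix.cornerHom B i 1 =
    rightInner (CStarMatrix ι ι B) z x}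
  add_mem' {x y} hx hy z := by rw [rightInner_add_right, add_mul, hx, hy]
  zero_mem' z := by rw [rightInner_zero_right, zero_mul]
  smul_mem' c x hx z := by rw [rightInner_smul_right, smul_mul_assoc, hx]

theorem isClosed_cornerSubmodule : IsClosed (cornerSubmodule B F i : Set F) := by
  have : (cornerSubmodule B F i : Set F) = ⋂ z : F, {x | rightInner (CStarMatrix ι ι B) z x *
      CStarMatrix.cornerHom B i 1 = rightInner (CStarMatrix ι ι B) z x} := by
    ext x
    simp [cornerSubmodule]
  rw [this]
  refine isClosed_iInter fun z => isClosed_eq ?_ (continuous_rightInner_right z)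
  exact (continuous_mul_const (CStarMatrix.cornerHom B i 1)).comp (continuous_rightInner_right z)

/-- The subspace `F · eᵢᵢ` as a Hilbert `B`-module. -/
def CornerModule : Type _ := ↥(cornerSubmodule B F i)

namespace CornerModule

instance : NormedAddCommGroup (CornerModule B F i) :=
  inferInstanceAs (NormedAddCommGroup ↥(cornerSubmodule B F i))

instance : NormedSpace ℂ (CornerModule B F i) :=
  inferInstanceAs (NormedSpace ℂ ↥(cornerSubmodule B F i))

instance [CompleteSpace F] : CompleteSpace (CornerModule B F i) :=
  (isClosed_cornerSubmodule B F i).completeSpace_coe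

variable {B F i}

theorem op_cornerHom_smul_mem (b : B) (x : F) :
    op (CStarMatrix.cornerHom B i b) • x ∈ cornerSubmodule B F i := fun z => by
  rw [rightInner_op_smul, mul_assoc, ← map_mul, mul_one]

/-- On the corner `⟨x, y⟩ = eᵢᵢ ⟨x, y⟩ eᵢᵢ`, so only one entry survives. As `cornerHom` is injective
and isometric, definiteness and the norm formula pass from `F` to the corner. -/
theorem rightInner_coe (x y : CornerModule B F i) :
    rightInner (CStarMatrix ι ι B) x.1 y.1 =
      CStarMatrix.cornerHom B i (rightInner (CStarMatrix ι ι B) x.1 y.1 i i) := by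
  have h1 := y.2 x.1
  have h2 := congrArg star (x.2 y.1)
  rw [star_mul, rightInner_star, ← map_star, star_one] at h2
  have h3 := CStarMatrix.cornerHom_mul_mul_cornerHom i
    (rightInner (CStarMatrix ι ι B) x.1 y.1) 1 1
  rw [h2, h1, one_mul, mul_one] at h3
  exact h3

theorem cornerHom_one_smul (x : CornerModule B F i) :
    op (CStarMatrix.cornerHom B i 1) • x.1 = x.1 :=
  ext_rightInner (B := CStarMatrix ι ι B) fun z => by rw [rightInner_op_smul, x.2]

instance : Module Bᵐᵒᵖ (CornerModule B F i) where
  smul b x := ⟨op (CStarMatrix.cornerHom B i (unop b)) • x.1, op_cornerHom_smul_mem _ _⟩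
  one_smul x := Subtype.ext (cornerHom_one_smul x)
  mul_smul a b x := Subtype.ext <| by
    change op (CStarMatrix.cornerHom B i (unop b * unop a)) • x.1 =
      op (CStarMatrix.cornerHom B i (unop a)) • op (CStarMatrix.cornerHom B i (unop b)) • x.1
    rw [map_mul, MulOpposite.op_mul, mul_smul]
  smul_zero a := Subtype.ext (smul_zero _)
  smul_add a x y := Subtype.ext (smul_add _ _ _)
  add_smul a b x := Subtype.ext <| by
    change op (CStarMatrix.cornerHom B i (unop a + unop b)) • x.1 =
      op (CStarMatrix.cornerHom B i (unop a)) • x.1 + op (CStarMatrix.cornerHom B i (unop b)) • x.1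
    rw [map_add, MulOpposite.op_add, add_smul]
  zero_smul x := Subtype.ext <| by
    change op (CStarMatrix.cornerHom B i 0) • x.1 = 0
    rw [map_zero, MulOpposite.op_zero, zero_smul]

instance : CStarModule Bᵐᵒᵖ (CornerModule B F i) where
  inner x y := op (rightInner (CStarMatrix ι ι B) x.1 y.1 i i)
  inner_add_right {x y z} := by
    change op (rightInner (CStarMatrix ι ι B) x.1 (y.1 + z.1) i i) = _
    rw [rightInner_add_right]
    rfl
  inner_self_nonneg {x} :=
    CStarMatrix.apply_self_nonneg (rightInner_self_nonneg (B := CStarMatrix ι ι B) x.1) i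
  inner_self {x} := by
    rw [MulOpposite.op_eq_zero_iff, ← map_eq_zero_iff _ (CStarMatrix.cornerHom_injective i),
      ← rightInner_coe]
    exact (MulOpposite.unop_eq_zero_iff _).trans
      ((CStarModule.inner_self (A := (CStarMatrix ι ι B)ᵐᵒᵖ)).trans
        (Submodule.coe_eq_zero (p := cornerSubmodule B F i)))
  inner_op_smul_right {a x y} := by
    change op (rightInner (CStarMatrix ι ι B) x.1
      (op (CStarMatrix.cornerHom B i (unop a)) • y.1) i i) = _
    rw [rightInner_op_smul, CStarMatrix.mul_cornerHom_apply_self]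
    rfl
  inner_smul_right_complex {c x y} := by
    change op (rightInner (CStarMatrix ι ι B) x.1 (c • y.1) i i) = _
    rw [rightInner_smul_right]
    rfl
  star_inner x y := by
    rw [← MulOpposite.op_star, ← CStarMatrix.star_apply, rightInner_star]
  norm_eq_sqrt_norm_inner_self x := by
    rw [MulOpposite.norm_op, ← CStarMatrix.norm_cornerHom i, ← rightInner_coe,
      ← norm_sq_eq_norm_rightInner, Real.sqrt_sq (norm_nonneg _)]
    rfl

theorem rightInner_eq (x y : CornerModule B F i) :
    rightInner B x y = rightInner (CStarMatrix ι ι B) x.1 y.1 i i := rfl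

theorem apply_mem (T : AdjointableOp (CStarMatrix ι ι B) F) (x : CornerModule B F i) :
    T x.1 ∈ cornerSubmodule B F i := fun z => by
  rw [AdjointableOp.rightInner_right, x.2]

/-- The restriction of an adjointable operator to the corner, as a bounded operator. -/
def restrictCLM (T : AdjointableOp (CStarMatrix ι ι B) F) :
    CornerModule B F i →L[ℂ] CornerModule B F i :=
  (T.toCLM.comp (cornerSubmodule B F i).subtypeL).codRestrict (cornerSubmodule B F i) (apply_mem T)

/-- The restriction of adjointable operators to the corner. -/
def restrict : AdjointableOp (CStarMatrix ι ι B) F →⋆ₐ[ℂ] AdjointableOp B (CornerModule B F i) where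
  toFun T := ⟨restrictCLM T, restrictCLM (star T), fun x y => by
    rw [rightInner_eq, rightInner_eq]
    exact congrArg (fun M : CStarMatrix ι ι B => M i i) (T.rightInner_left x.1 y.1)⟩
  map_one' := rfl
  map_zero' := rfl
  map_add' _ _ := rfl
  map_mul' _ _ := rfl
  commutes' _ := rfl
  map_star' T := AdjointableOp.ext_of_rightInner fun x y => by
    refine Eq.trans ?_ (AdjointableOp.rightInner_left _ x y)
    exact (congrArg (fun M : CStarMatrix ι ι B => M i i) (T.rightInner_left x.1 y.1)).symm

end CornerModule

end Corner

/-! ### Descent from the ampliations to the maps. -/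

section Descent

variable {A : Type u} {B : Type v}
  [CStarAlgebra A] [PartialOrder A] [StarOrderedRing A]
  [CStarAlgebra B] [PartialOrder B] [StarOrderedRing B]

/-- Moving both copies of `eᵢᵢ` out gives `eᵢᵢ ⟨x, T x⟩ eᵢᵢ`, with the same `(i, i)` entry. The case
`T = 1` normalises the vector; the others give the representation formulas. -/
theorem rightInner_corner {F : Type*} [NormedAddCommGroup F] [NormedSpace ℂ F]
    {ι : Type*} [Fintype ι] [DecidableEq ι] [Module (CStarMatrix ι ι B)ᵐᵒᵖ F]
    [CStarModule (CStarMatrix ι ι B)ᵐᵒᵖ F] (i : ι) (x : F)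
    (T : AdjointableOp (CStarMatrix ι ι B) F) :
    rightInner (CStarMatrix ι ι B) (op (CStarMatrix.cornerHom B i 1) • x)
      (T (op (CStarMatrix.cornerHom B i 1) • x)) i i =
      rightInner (CStarMatrix ι ι B) x (T x) i i := by
  rw [AdjointableOp.map_op_smul, rightInner_op_smul_left, rightInner_op_smul, ← mul_assoc,
    ← map_star, star_one, CStarMatrix.cornerHom_mul_mul_cornerHom,
    CStarMatrix.cornerHom_apply_self, one_mul, mul_one]

/-- A joint representation of the ampliations yields one of the maps themselves, on a corner of the
Hilbert module. -/
def JointRepresentation.corner {φ ψ : UCP A B} {n : ℕ}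
    (R : JointRepresentation (φ.ampliation n) (ψ.ampliation n)) (i : Fin n) :
    JointRepresentation φ ψ where
  E := CornerModule B R.E i
  σ₁ := CornerModule.restrict.comp (R.σ₁.comp (CStarMatrix.scalarHom (Fin n) A))
  σ₂ := CornerModule.restrict.comp (R.σ₂.comp (CStarMatrix.scalarHom (Fin n) A))
  x := ⟨op (CStarMatrix.cornerHom B i 1) • R.x, CornerModule.op_cornerHom_smul_mem _ _⟩
  unit_vector := by
    refine (rightInner_corner i R.x 1).trans ?_
    refine (congrArg (fun M : CStarMatrix (Fin n) (Fin n) B => M i i) R.unit_vector).trans ?_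
    exact CStarMatrix.one_apply_eq i
  repr₁ a := by
    refine Eq.trans ?_ (rightInner_corner i R.x _).symm
    refine Eq.trans ?_ (congrArg (fun M : CStarMatrix (Fin n) (Fin n) B => M i i) (R.repr₁ _))
    exact congrArg φ (CStarMatrix.scalarHom_apply_self a i).symm
  repr₂ a := by
    refine Eq.trans ?_ (rightInner_corner i R.x _).symm
    refine Eq.trans ?_ (congrArg (fun M : CStarMatrix (Fin n) (Fin n) B => M i i) (R.repr₂ _))
    exact congrArg ψ (CStarMatrix.scalarHom_apply_self a i).symm

theorem reprDist_le_reprDist_ampliation (φ ψ : UCP A B) {n : ℕ} (i : Fin n) :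
    reprDist φ ψ ≤ reprDist (φ.ampliation n) (ψ.ampliation n) := by
  refine le_iInf fun R => (iInf_le _ (R.corner i)).trans ?_
  let r := CornerModule.restrict (B := B) (F := R.E) (i := i)
  let d := CStarMatrix.scalarHom (Fin n) A
  have h1 := cbNorm_sub_comp_left_le r (R.σ₁.comp d) (R.σ₂.comp d)
  exact h1.trans (cbNorm_sub_comp_right_le R.σ₁ R.σ₂ d)

end Descent

/-! ### Matrices over a Hilbert module -/

theorem AdjointableOp.sum_apply {B : Type*} [CStarAlgebra B] [PartialOrder B] {E : Type*}
    [NormedAddCommGroup E] [NormedSpace ℂ E] [Module Bᵐᵒᵖ E] [CStarModule Bᵐᵒᵖ E]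
    {κ : Type*} (s : Finset κ) (T : κ → AdjointableOp B E) (x : E) :
    (∑ k ∈ s, T k) x = ∑ k ∈ s, T k x := by
  let ev : AdjointableOp B E →+ E :=
    { toFun := fun T => T x
      map_zero' := rfl
      map_add' := fun _ _ => rfl }
  exact map_sum ev T s

/-- The square matrices with entries in a Hilbert `B`-module, as a Hilbert module over the matrices
with entries in `B`. -/
def MatrixModule (_B : Type*) (ι : Type*) (E : Type*) : Type _ := ι → ι → E

namespace MatrixModule

variable {B : Type*} {ι : Type*} {E : Type*} [NormedAddCommGroup E] [NormedSpace ℂ E]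

instance : AddCommGroup (MatrixModule B ι E) := inferInstanceAs (AddCommGroup (ι → ι → E))

instance : Module ℂ (MatrixModule B ι E) := inferInstanceAs (Module ℂ (ι → ι → E))

theorem ext {x y : MatrixModule B ι E} (h : ∀ k j, x k j = y k j) : x = y :=
  funext fun k => funext fun j => h k j

variable [Fintype ι] [DecidableEq ι] [CStarAlgebra B] [PartialOrder B]
  [StarOrderedRing B] [Module Bᵐᵒᵖ E] [CStarModule Bᵐᵒᵖ E]

instance : Module (CStarMatrix ι ι B)ᵐᵒᵖ (MatrixModule B ι E) where
  smul M x := fun k j => ∑ l, op (unop M l j) • x k l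
  one_smul x := ext fun k j => by
    change ∑ l, op ((1 : CStarMatrix ι ι B) l j) • x k l = x k j
    rw [Finset.sum_eq_single j]
    · simp
    · intro l _ hl
      simp [hl]
    · simp
  mul_smul M N x := ext fun k j => by
    change ∑ l, op ((unop N * unop M) l j) • x k l =
      ∑ l, op (unop M l j) • ∑ m, op (unop N m l) • x k m
    simp only [CStarMatrix.mul_apply, Finset.op_sum, Finset.sum_smul, Finset.smul_sum,
      MulOpposite.op_mul, mul_smul]
    exact Finset.sum_comm
  smul_zero M := ext fun k j => Finset.sum_eq_zero fun l _ => smul_zero _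
  smul_add M x y := ext fun k j =>
    (Finset.sum_congr rfl fun l _ => smul_add _ _ _).trans Finset.sum_add_distrib
  add_smul M N x := ext fun k j =>
    (Finset.sum_congr rfl fun l _ => add_smul (op (unop M l j)) (op (unop N l j)) (x k l)).trans
      Finset.sum_add_distrib
  zero_smul x := ext fun k j => Finset.sum_eq_zero fun l _ => zero_smul Bᵐᵒᵖ (x k l)

theorem op_smul_apply (M : CStarMatrix ι ι B) (x : MatrixModule B ι E) (k j : ι) :
    (op M • x) k j = ∑ l, op (M l j) • x k l := rfl

/-- The matrix-valued inner product on the matrices over a Hilbert `B`-module. -/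
def matrixInner (x y : MatrixModule B ι E) : CStarMatrix ι ι B :=
  CStarMatrix.ofMatrix fun i j => ∑ k, rightInner B (x k i) (y k j)

theorem matrixInner_apply (x y : MatrixModule B ι E) (i j : ι) :
    matrixInner x y i j = ∑ k, rightInner B (x k i) (y k j) := rfl

theorem matrixInner_star (x y : MatrixModule B ι E) :
    star (matrixInner x y) = matrixInner y x := by
  ext i j
  rw [CStarMatrix.star_apply, matrixInner_apply, matrixInner_apply, star_sum]
  simp only [rightInner_star]

theorem matrixInner_op_smul_right (x y : MatrixModule B ι E) (M : CStarMatrix ι ι B) :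
    matrixInner x (op M • y) = matrixInner x y * M := by
  ext i j
  simp only [CStarMatrix.mul_apply, matrixInner_apply, op_smul_apply, rightInner_sum_right,
    rightInner_op_smul, Finset.sum_mul]
  exact Finset.sum_comm

theorem matrixInner_op_smul_left (x y : MatrixModule B ι E) (M : CStarMatrix ι ι B) :
    matrixInner (op M • x) y = star M * matrixInner x y := by
  rw [← matrixInner_star, matrixInner_op_smul_right, star_mul, matrixInner_star]

theorem matrixInner_self_apply_self_nonneg (x : MatrixModule B ι E) (i : ι) :
    0 ≤ matrixInner x x i i :=
  Finset.sum_nonneg fun k _ => rightInner_self_nonneg (x k i)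

/-- The identity `N⋆ ⟨x, x⟩ N = ⟨x N, x N⟩` reduces positivity to diagonal entries, which are sums
of positive elements. -/
theorem matrixInner_self_nonneg (x : MatrixModule B ι E) : 0 ≤ matrixInner x x :=
  CStarMatrix.nonneg_of_forall_star_mul_mul_apply_self (matrixInner_star x x) fun N i => by
    rw [← matrixInner_op_smul_left, ← matrixInner_op_smul_right]
    exact matrixInner_self_apply_self_nonneg _ i

theorem rightInner_self_le_matrixInner (x : MatrixModule B ι E) (k i : ι) :
    rightInner B (x k i) (x k i) ≤ matrixInner x x i i :=
  Finset.single_le_sum (f := fun k => rightInner B (x k i) (x k i))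
    (fun k _ => rightInner_self_nonneg (x k i)) (Finset.mem_univ k)

theorem matrixInner_self_eq_zero {x : MatrixModule B ι E} : matrixInner x x = 0 ↔ x = 0 := by
  refine ⟨fun h => ext fun k i => ?_, fun h => ?_⟩
  · have h1 := rightInner_self_le_matrixInner x k i
    rw [h] at h1
    have h2 : rightInner B (x k i) (x k i) = 0 := le_antisymm h1 (rightInner_self_nonneg _)
    exact (CStarModule.inner_self (A := Bᵐᵒᵖ)).1 (MulOpposite.unop_injective h2)
  · subst h
    ext i j
    exact Finset.sum_eq_zero fun k _ => rightInner_zero_right (B := B) (0 : E)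

/-- The norm precedes the `CStarModule` structure, whose last field refers to it; the norm axioms
are then deduced from that structure. -/
instance : Norm (MatrixModule B ι E) := ⟨fun x => √‖matrixInner x x‖⟩

instance : CStarModule (CStarMatrix ι ι B)ᵐᵒᵖ (MatrixModule B ι E) where
  inner x y := op (matrixInner x y)
  inner_add_right {x y z} := congrArg op <| by
    ext i j
    exact (Finset.sum_congr rfl fun k _ => rightInner_add_right (x k i) (y k j) (z k j)).trans
      Finset.sum_add_distrib
  inner_self_nonneg {x} := matrixInner_self_nonneg x
  inner_self {x} := (MulOpposite.op_eq_zero_iff _).trans matrixInner_self_eq_zero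
  inner_op_smul_right {a x y} := congrArg op (matrixInner_op_smul_right x y (unop a))
  inner_smul_right_complex {c x y} := congrArg op <| by
    ext i j
    exact (Finset.sum_congr rfl fun k _ => rightInner_smul_right (x k i) (y k j) c).trans
      Finset.smul_sum.symm
  star_inner x y := congrArg op (matrixInner_star x y)
  norm_eq_sqrt_norm_inner_self _ := rfl

instance : NormedAddCommGroup (MatrixModule B ι E) :=
  .ofCore (CStarModule.normedSpaceCore (CStarMatrix ι ι B)ᵐᵒᵖ)

instance : NormedSpace ℂ (MatrixModule B ι E) :=
  .ofCore (CStarModule.normedSpaceCore (CStarMatrix ι ι B)ᵐᵒᵖ)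

theorem rightInner_apply (x y : MatrixModule B ι E) (i j : ι) :
    rightInner (CStarMatrix ι ι B) x y i j = ∑ k, rightInner B (x k i) (y k j) := rfl

theorem norm_apply_le (x : MatrixModule B ι E) (k i : ι) : ‖x k i‖ ≤ ‖x‖ := by
  refine Real.le_sqrt_of_sq_le ?_
  rw [norm_sq_eq_norm_rightInner (B := B)]
  exact (CStarAlgebra.norm_le_norm_of_nonneg_of_le (rightInner_self_nonneg _)
    (rightInner_self_le_matrixInner x k i)).trans CStarMatrix.norm_entry_le_norm

/-- The entries of the inner product are finite sums of continuous functions of the entries of `x`,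
so no explicit bound is needed. -/
theorem continuous_norm_pi :
    Continuous fun x : ι → ι → E => ‖(show MatrixModule B ι E from x)‖ := by
  refine Real.continuous_sqrt.comp (Continuous.norm ?_)
  refine continuous_pi fun i => continuous_pi fun j => continuous_finsetSum _ fun k _ => ?_
  exact (MulOpposite.continuous_unop.comp (CStarModule.continuous_inner (A := Bᵐᵒᵖ))).comp
    (Continuous.prodMk (by fun_prop : Continuous fun x : ι → ι → E => x k i)
      (by fun_prop : Continuous fun x : ι → ι → E => x k j))

/-- The norm of the Hilbert module of matrices induces the topology of entrywise convergence. -/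
def piEquiv : MatrixModule B ι E ≃L[ℂ] (ι → ι → E) where
  toFun x := x
  invFun x := x
  left_inv _ := rfl
  right_inv _ := rfl
  map_add' _ _ := rfl
  map_smul' _ _ := rfl
  continuous_toFun := by
    let entry (k i : ι) : MatrixModule B ι E →ₗ[ℂ] E :=
      { toFun := fun x => x k i
        map_add' := fun _ _ => rfl
        map_smul' := fun _ _ => rfl }
    exact continuous_pi fun k => continuous_pi fun i =>
      AddMonoidHomClass.continuous_of_bound (entry k i) 1 fun x =>
        (norm_apply_le x k i).trans_eq (one_mul _).symm
  continuous_invFun := by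
    let inv : (ι → ι → E) →ₗ[ℂ] MatrixModule B ι E :=
      { toFun := fun x => x
        map_add' := fun _ _ => rfl
        map_smul' := fun _ _ => rfl }
    -- By linearity, continuity at `0` suffices, and there it is the continuity of the module norm
    -- in the product topology.
    refine continuous_of_continuousAt_zero inv ?_
    have h := (continuous_norm_pi (B := B) (ι := ι) (E := E)).tendsto 0
    have h0 : ‖(show MatrixModule B ι E from (0 : ι → ι → E))‖ = 0 :=
      norm_zero (E := MatrixModule B ι E)
    rw [h0] at h
    rw [ContinuousAt, map_zero, tendsto_zero_iff_norm_tendsto_zero]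
    exact h

instance [CompleteSpace E] : CompleteSpace (MatrixModule B ι E) :=
  have h : IsUniformEmbedding (piEquiv (B := B) (ι := ι) (E := E)) :=
    ContinuousLinearEquiv.isUniformEmbedding _
  (completeSpace_congr (e := (piEquiv (B := B) (ι := ι) (E := E)).toLinearEquiv.toEquiv) h).2
    (inferInstanceAs (CompleteSpace (ι → ι → E)))

/-- The action of a matrix of adjointable operators on the matrices over a Hilbert module, as a
bounded operator. -/
def mulLeftCLM (T : CStarMatrix ι ι (AdjointableOp B E)) :
    MatrixModule B ι E →L[ℂ] MatrixModule B ι E where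
  toFun x := fun k j => ∑ l, T k l (x l j)
  map_add' x y := ext fun k j =>
    (Finset.sum_congr rfl fun l _ => map_add (T k l).toCLM (x l j) (y l j)).trans
      Finset.sum_add_distrib
  map_smul' c x := ext fun k j =>
    (Finset.sum_congr rfl fun l _ => map_smul (T k l).toCLM c (x l j)).trans
      Finset.smul_sum.symm
  cont := by
    refine (piEquiv (B := B)).symm.continuous.comp (g := (piEquiv (B := B)).symm)
      (f := fun x : MatrixModule B ι E => fun k j => ∑ l, T k l (x l j)) ?_
    refine continuous_pi fun k => continuous_pi fun j => continuous_finsetSum _ fun l _ => ?_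
    refine (T k l).toCLM.continuous.comp ?_
    exact (continuous_apply j).comp ((continuous_apply l).comp (piEquiv (B := B)).continuous)

theorem mulLeftCLM_apply (T : CStarMatrix ι ι (AdjointableOp B E)) (x : MatrixModule B ι E)
    (k j : ι) : mulLeftCLM T x k j = ∑ l, T k l (x l j) := rfl

theorem isModuleAdjoint_mulLeftCLM (T : CStarMatrix ι ι (AdjointableOp B E)) :
    IsModuleAdjoint (CStarMatrix ι ι B) (mulLeftCLM T) (mulLeftCLM (star T)) := fun x y => by
  ext i j
  simp only [rightInner_apply, mulLeftCLM_apply, rightInner_sum_left, rightInner_sum_right,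
    CStarMatrix.star_apply, AdjointableOp.rightInner_left]
  exact Finset.sum_comm

/-- The action of a matrix of adjointable operators on the matrices over a Hilbert module. -/
def mulLeftOp (T : CStarMatrix ι ι (AdjointableOp B E)) :
    AdjointableOp (CStarMatrix ι ι B) (MatrixModule B ι E) :=
  ⟨mulLeftCLM T, mulLeftCLM (star T), isModuleAdjoint_mulLeftCLM T⟩

theorem mulLeftOp_apply (T : CStarMatrix ι ι (AdjointableOp B E)) (x : MatrixModule B ι E)
    (k j : ι) : mulLeftOp T x k j = ∑ l, T k l (x l j) := rfl

theorem adjointableOp_ext {S T : AdjointableOp (CStarMatrix ι ι B) (MatrixModule B ι E)}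
    (h : ∀ x k j, S x k j = T x k j) : S = T :=
  AdjointableOp.toCLM_injective (ContinuousLinearMap.ext fun x => ext (h x))

/-- General scalars serve both `map_one'` (with `c = 1`) and `commutes'` of `mulLeft`. -/
theorem mulLeftOp_smul_one (c : ℂ) :
    mulLeftOp (c • 1 : CStarMatrix ι ι (AdjointableOp B E)) = c • 1 :=
  adjointableOp_ext fun x k j => by
    rw [mulLeftOp_apply, Finset.sum_eq_single k]
    · rw [CStarMatrix.smul_apply, CStarMatrix.one_apply_eq]
      rfl
    · intro l _ hl
      rw [CStarMatrix.smul_apply, CStarMatrix.one_apply_ne hl.symm, smul_zero]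
      rfl
    · simp

theorem mulLeftOp_zero : mulLeftOp (0 : CStarMatrix ι ι (AdjointableOp B E)) = 0 :=
  adjointableOp_ext fun _ _ _ => Finset.sum_eq_zero fun _ _ => rfl

theorem mulLeftOp_add (S T : CStarMatrix ι ι (AdjointableOp B E)) :
    mulLeftOp (S + T) = mulLeftOp S + mulLeftOp T :=
  adjointableOp_ext fun _ _ _ => Finset.sum_add_distrib

theorem mulLeftOp_mul (S T : CStarMatrix ι ι (AdjointableOp B E)) :
    mulLeftOp (S * T) = mulLeftOp S * mulLeftOp T :=
  adjointableOp_ext fun x k j => by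
    refine Eq.trans ?_ (mulLeftOp_apply S (mulLeftOp T x) k j).symm
    simp only [CStarMatrix.mul_apply, AdjointableOp.sum_apply, mulLeftOp_apply, map_sum]
    exact Finset.sum_comm

theorem mulLeftOp_star (T : CStarMatrix ι ι (AdjointableOp B E)) :
    mulLeftOp (star T) = star (mulLeftOp T) :=
  AdjointableOp.ext_of_rightInner fun x y => by
    rw [← AdjointableOp.rightInner_left]
    exact (isModuleAdjoint_mulLeftCLM T x y).symm

/-- Matrices of adjointable operators act by adjointable operators on the matrices over a Hilbert
module. -/
def mulLeft [CompleteSpace E] : CStarMatrix ι ι (AdjointableOp B E) →⋆ₐ[ℂ]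
    AdjointableOp (CStarMatrix ι ι B) (MatrixModule B ι E) where
  toFun := mulLeftOp
  map_one' := by
    have := mulLeftOp_smul_one (ι := ι) (B := B) (E := E) 1
    rwa [one_smul, one_smul] at this
  map_zero' := mulLeftOp_zero
  map_add' := mulLeftOp_add
  map_mul' := mulLeftOp_mul
  commutes' c := by
    rw [Algebra.algebraMap_eq_smul_one, Algebra.algebraMap_eq_smul_one]
    exact mulLeftOp_smul_one c
  map_star' := mulLeftOp_star

theorem mulLeft_apply [CompleteSpace E] (T : CStarMatrix ι ι (AdjointableOp B E))
    (x : MatrixModule B ι E) (k j : ι) : mulLeft T x k j = ∑ l, T k l (x l j) :=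
  rfl

/-- The diagonal matrix with all diagonal entries equal to `x`. -/
def diag (x : E) : MatrixModule B ι E := fun k j => if k = j then x else 0

/-- Only the terms `k = i` and `l = j` survive; this single computation gives normalisation and both
representation formulas. -/
theorem rightInner_diag_mulLeft_diag [CompleteSpace E] (T : CStarMatrix ι ι (AdjointableOp B E))
    (x : E) (i j : ι) :
    rightInner (CStarMatrix ι ι B) (diag x) (mulLeft T (diag x)) i j = rightInner B x (T i j x) := by
  rw [rightInner_apply, Finset.sum_eq_single i]
  · rw [mulLeft_apply, Finset.sum_eq_single j]
    · simp [diag]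
    · intro l _ hl
      simp [diag, hl]
    · simp
  · intro k _ hk
    simp [diag, hk, rightInner_zero_left]
  · simp

end MatrixModule

/-! ### Ascent from the maps to the ampliations. -/

section Ampliation

variable {A : Type u} {B : Type v}
  [CStarAlgebra A] [PartialOrder A] [StarOrderedRing A]
  [CStarAlgebra B] [PartialOrder B] [StarOrderedRing B]

/-- The ampliation of a joint representation, on the matrices over the Hilbert module. -/
def JointRepresentation.ampliation {φ ψ : UCP A B} (n : ℕ) (R : JointRepresentation φ ψ) :
    JointRepresentation (φ.ampliation n) (ψ.ampliation n) where
  E := MatrixModule B (Fin n) R.E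
  σ₁ := MatrixModule.mulLeft.comp (CStarMatrix.mapHom (Fin n) R.σ₁)
  σ₂ := MatrixModule.mulLeft.comp (CStarMatrix.mapHom (Fin n) R.σ₂)
  x := MatrixModule.diag R.x
  unit_vector := by
    have h1 : (MatrixModule.mulLeft (1 : CStarMatrix (Fin n) (Fin n) (AdjointableOp B R.E)))
        (MatrixModule.diag R.x) = MatrixModule.diag R.x := by
      rw [map_one]
      rfl
    ext i j
    -- The identity is inserted as `mulLeft 1` in both arguments, then removed from the left one, so
    -- that the formula for `diag` applies with `T = 1`.
    rw [← h1]
    nth_rw 1 [h1]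
    rw [MatrixModule.rightInner_diag_mulLeft_diag, CStarMatrix.one_apply, CStarMatrix.one_apply]
    split_ifs
    · exact R.unit_vector
    · exact rightInner_zero_right _
  repr₁ M := by
    ext i j
    refine Eq.trans ?_ (MatrixModule.rightInner_diag_mulLeft_diag _ R.x i j).symm
    exact R.repr₁ (M i j)
  repr₂ M := by
    ext i j
    refine Eq.trans ?_ (MatrixModule.rightInner_diag_mulLeft_diag _ R.x i j).symm
    exact R.repr₂ (M i j)

/-- The difference of the new actions is `mulLeft` after the ampliation of `σ₁ - σ₂`, and neither
step increases the cb-norm. -/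
theorem reprDist_ampliation_le_reprDist (φ ψ : UCP A B) (n : ℕ) :
    reprDist (φ.ampliation n) (ψ.ampliation n) ≤ reprDist φ ψ := by
  refine le_iInf fun R => (iInf_le _ (R.ampliation n)).trans ?_
  let r := MatrixModule.mulLeft (B := B) (ι := Fin n) (E := R.E)
  have h1 := cbNorm_sub_comp_left_le r (CStarMatrix.mapHom (Fin n) R.σ₁)
    (CStarMatrix.mapHom (Fin n) R.σ₂)
  exact h1.trans (cbNorm_mapₗ_le n (R.σ₁.toAlgHom.toLinearMap - R.σ₂.toAlgHom.toLinearMap))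

end Ampliation

end

theorem mainTheorem9 {A : Type u} {B : Type v}
    [CStarAlgebra A] [PartialOrder A] [StarOrderedRing A]
    [CStarAlgebra B] [PartialOrder B] [StarOrderedRing B] [WStarAlgebra B]
    (φ ψ : UCP A B) (n : ℕ) (hn : 1 ≤ n) :
    reprDist φ ψ = reprDist (φ.ampliation n) (ψ.ampliation n) :=
  -- A corner needs an index; `1 ≤ n` supplies `0`.
  le_antisymm (reprDist_le_reprDist_ampliation φ ψ ⟨0, hn⟩)
    (reprDist_ampliation_le_reprDist φ ψ n)
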